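/- Let $0<\sigma_0^2<\sigma_1^2$ be known variances, and let $H_2$ be the hypothesis that $y=(y_0,\dots,y_{N-1})$ are i.i.d. $\mathcal N(0,\sigma_2^2)$ samples with unknown variance $\sigma_2^2\in(\sigma_0^2,\sigma_1^2)\cup(\sigma_1^2,\infty)$. Write $p(y;v)=\prod_{n=0}^{N-1}(2\pi v)^{-1/2}e^{-y_n^2/(2v)}$, let $\hat\sigma_2^2=\arg\max_{v>0}p(y;v)$ be the maximum likelihood estimate of the variance (it exists and is unique for $y\neq 0$), and let $L_1=p(y;\hat\sigma_2^2)/p(y;\sigma_1^2)$ be the generalized likelihood ratio. Let $z=\operatorname{sgn}\big((\sigma_2^2-\sigma_1^2)(\hat\sigma_2^2-\sigma_1^2)\big)\sqrt{2\ln L_1}$. Let $I(\sigma_1^2)=-E_{\sigma_1^2}\big[\partial_v^2\ln p(y;v)|_{v=\sigma_1^2}\big]$ be the Fisher information of the $N$ samples at $\sigma_1^2$, let $\theta=\theta_N(\sigma_2^2)=(\sigma_2^2-\sigma_1^2)^2I(\sigma_1^2)$, and let $\chi'^2_1(\theta)$ be the noncentral chi-square distribution with one degree of freedom and noncentrality $\theta$,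 i.e. the law of $X^2$ with $X\sim\mathcal N(\sqrt\theta,1)$. Then: (i) For every $N$, $v\mapsto\ln p(y;v)$ is twice continuously differentiable at $v=\sigma_1^2$ for every $y$, its second derivative there is integrable under $\mathcal N(0,\sigma_1^2)^{\otimes N}$, and $I(\sigma_1^2)=N/(2\sigma_1^4)$. Consequently $\sqrt\theta=\left|\sigma_2^2/\sigma_1^2-1\right|\sqrt{N/2}$ for every $\sigma_2^2$ in $H_2$. For every $N\ge1$, $z^2=2\ln L_1$ almost surely under $H_2$. (ii) Under $H_2$, for large $N$, the distribution functions of $2\ln L_1$ and of $z$ are approximated by those of $\chi'^2_1(\theta)$ and $\mathcal N(\sqrt\theta,1)$ up to any fixed level, uniformly over all of $H_2$: for every $C\in\mathbb R$, $$\sup_{\sigma_2^2}\ \sup_{c\le C}\Big|P_{\sigma_2^2}(2\ln L_1\le c)-\chi'^2_1(\theta)\big((-\infty,c]\big)\Big|\to0,\qquad \sup_{\sigma_2^2}\ \sup_{c\le C}\Big|P_{\sigma_2^2}(z\le c)-\mathcal N(\sqrt\theta,1)\big((-\infty,c]\big)\Big|\to0$$ as $N\to\infty$, where $\sigma_2^2$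 ranges over $(\sigma_0^2,\sigma_1^2)\cup(\sigma_1^2,\infty)$. (iii) The approximation holds for the whole distribution functions, uniformly over all levels, for the variances in $H_2$ for which $\theta$ is small compared with $\sqrt N$: for every $\varepsilon>0$ there are $\delta>0$ and $N_0$ such that for all $N\ge N_0$ and all $\sigma_2^2$ in $H_2$ with $\theta_N(\sigma_2^2)\le\delta\sqrt N$, both differences in (ii) have absolute value at most $\varepsilon$ for every $c\in\mathbb R$. In particular this covers all local alternatives, $|\sigma_2^2-\sigma_1^2|=O(N^{-1/2})$. -/

import Mathlib

open MeasureTheory ProbabilityTheory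

noncomputable section

namespace SpectrumMisuse

/-- The law of `N` i.i.d. samples `y₀, …, y_{N-1}` with distribution `𝒩(0, v)`, where `v > 0` is
the variance. -/
def sampleLaw (N : ℕ) (v : ℝ) : Measure (Fin N → ℝ) :=
  Measure.pi fun _ => gaussianReal 0 v.toNNReal

/-- The likelihood `p(y; v)`: the joint density at `y` of `N` i.i.d. `𝒩(0, v)` samples. -/
def likelihood {N : ℕ} (y : Fin N → ℝ) (v : ℝ) : ℝ :=
  ∏ i, gaussianPDFReal 0 v.toNNReal (y i)

/-- `u` maximises the likelihood `v ↦ p(y; v)` over all variances `v > 0`. -/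
def IsVarianceMLE {N : ℕ} (y : Fin N → ℝ) (u : ℝ) : Prop :=
  0 < u ∧ ∀ v : ℝ, 0 < v → likelihood y v ≤ likelihood y u

/-- The maximum likelihood estimate `argmax_{v > 0} p(y; v)` of the variance. The maximiser exists
and is unique when `y ≠ 0` (see `varianceMLE_eq`); for `y = 0` there is none, and the value is
arbitrary. -/
def varianceMLE {N : ℕ} (y : Fin N → ℝ) : ℝ :=
  Classical.epsilon (IsVarianceMLE y)

/-- The generalized likelihood ratio `L₁(y) = p(y; σ̂₂²) / p(y; σ₁²)`, where `s₁ = σ₁²`. -/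
def L1 (s₁ : ℝ) {N : ℕ} (y : Fin N → ℝ) : ℝ :=
  likelihood y (varianceMLE y) / likelihood y s₁

/-- The signed square root `z` of `2 ln L₁`: its sign is positive exactly when the estimated
variance lies on the same side of `s₁ = σ₁²` as the true variance `s₂ = σ₂²`. -/
def zStat (s₁ s₂ : ℝ) {N : ℕ} (y : Fin N → ℝ) : ℝ :=
  Real.sign ((s₂ - s₁) * (varianceMLE y - s₁)) * √(2 * Real.log (L1 s₁ y))

/-- The second derivative `∂² ln p(y; v) / ∂v²` of the log-likelihood in the variance `v`. -/
def logLikelihoodSecondDeriv {N : ℕ} (y : Fin N → ℝ) (v : ℝ) : ℝ :=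
  iteratedDeriv 2 (fun u => Real.log (likelihood y u)) v

/-- The Fisher information `I(v) = -E_v[∂² ln p(y; v) / ∂v²]` of `N` samples on the variance. -/
def fisherInfo (N : ℕ) (v : ℝ) : ℝ :=
  -∫ y, logLikelihoodSecondDeriv y v ∂(sampleLaw N v)

/-- The noncentrality parameter `θ = (σ₂² - σ₁²)² I(σ₁²)`. -/
def noncentrality (N : ℕ) (s₁ s₂ : ℝ) : ℝ :=
  (s₂ - s₁) ^ 2 * fisherInfo N s₁

/-- The noncentral chi-square distribution `χ'²₁(θ)` with one degree of freedom and noncentrality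
`θ ≥ 0`: the law of `X²` with `X ∼ 𝒩(√θ, 1)`. -/
def noncentralChiSqOne (θ : ℝ) : Measure ℝ :=
  (gaussianReal (√θ) 1).map fun x => x ^ 2

/-- The variances allowed by the hypothesis `H₂`: `σ² ∈ (σ₀², σ₁²) ∪ (σ₁², ∞)`. -/
def hypothesisH2 (s₀ s₁ : ℝ) : Set ℝ := Set.Ioo s₀ s₁ ∪ Set.Ioi s₁

theorem likelihood_pos {N : ℕ} (y : Fin N → ℝ) {v : ℝ} (hv : 0 < v) : 0 < likelihood y v :=
  Finset.prod_pos fun i _ => gaussianPDFReal_pos 0 _ _ (by simpa using hv)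

theorem log_likelihood {N : ℕ} (y : Fin N → ℝ) {v : ℝ} (hv : 0 < v) :
    Real.log (likelihood y v)
      = -(N / 2 * Real.log (2 * Real.pi * v)) - (∑ i, y i ^ 2) / (2 * v) := by
  have hpi : 0 < 2 * Real.pi * v := by positivity
  unfold likelihood
  rw [Real.log_prod (fun i _ => (gaussianPDFReal_pos 0 _ _ (by simpa using hv)).ne')]
  have h : ∀ i, Real.log (gaussianPDFReal 0 v.toNNReal (y i))
      = -(1 / 2 * Real.log (2 * Real.pi * v)) - y i ^ 2 / (2 * v) := by
    intro i
    rw [gaussianPDFReal, Real.coe_toNNReal _ hv.le,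
      Real.log_mul (by positivity) (Real.exp_pos _).ne', Real.log_inv, Real.log_exp,
      Real.log_sqrt hpi.le]
    ring
  simp only [h, Finset.sum_sub_distrib, Finset.sum_const, Finset.card_univ, Fintype.card_fin,
    nsmul_eq_mul, ← Finset.sum_div]
  ring

/-- For `y ≠ 0` the maximum likelihood estimate exists, is unique, and is the mean square. -/
theorem isVarianceMLE_iff {N : ℕ} {y : Fin N → ℝ} (hy : y ≠ 0) (u : ℝ) :
    IsVarianceMLE y u ↔ u = (∑ i, y i ^ 2) / N := by
  obtain ⟨j, hj⟩ : ∃ j, y j ≠ 0 := Function.ne_iff.mp hy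
  have hN : (0 : ℝ) < N := by exact_mod_cast (Fin.pos j)
  have hS : 0 < ∑ i, y i ^ 2 :=
    Finset.sum_pos' (fun i _ => sq_nonneg _) ⟨j, Finset.mem_univ _, by positivity⟩
  set m : ℝ := (∑ i, y i ^ 2) / N with hm
  have hSm : ∑ i, y i ^ 2 = N * m := by rw [hm]; field_simp
  have hm0 : 0 < m := div_pos hS hN
  have hdiff : ∀ v : ℝ, 0 < v → Real.log (likelihood y m) - Real.log (likelihood y v)
      = N / 2 * (m / v - 1 - Real.log (m / v)) := by
    intro v hv
    rw [log_likelihood y hm0, log_likelihood y hv, hSm,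
      Real.log_mul (by positivity) hm0.ne', Real.log_mul (by positivity) hv.ne',
      Real.log_div hm0.ne' hv.ne']
    field_simp
    ring
  have hmax : IsVarianceMLE y m := by
    refine ⟨hm0, fun v hv => ?_⟩
    rw [← Real.log_le_log_iff (likelihood_pos y hv) (likelihood_pos y hm0), ← sub_nonneg,
      hdiff v hv]
    have := Real.log_le_sub_one_of_pos (div_pos hm0 hv)
    exact mul_nonneg (by positivity) (by linarith)
  refine ⟨fun hu => ?_, fun hu => hu ▸ hmax⟩
  by_contra hne
  have h1 := hu.2 m hm0
  rw [← Real.log_le_log_iff (likelihood_pos y hm0) (likelihood_pos y hu.1), ← sub_nonpos,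
    hdiff u hu.1] at h1
  have h2 := Real.log_lt_sub_one_of_pos (div_pos hm0 hu.1)
    (fun h => hne ((div_eq_one_iff_eq hu.1.ne').mp h).symm)
  have h3 : 0 < (N : ℝ) / 2 * (m / u - 1 - Real.log (m / u)) :=
    mul_pos (by positivity) (by linarith)
  linarith

theorem varianceMLE_eq {N : ℕ} {y : Fin N → ℝ} (hy : y ≠ 0) :
    varianceMLE y = (∑ i, y i ^ 2) / N :=
  (isVarianceMLE_iff hy _).mp
    (Classical.epsilon_spec ⟨_, (isVarianceMLE_iff hy _).mpr rfl⟩)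

end SpectrumMisuse

end

open Filter Topology

namespace SpectrumMisuse

/-! ### The signed root of the Gaussian variance deviance -/

/-! Put `r = s₂ / s₁`, `k = √(N/2)`, `σ = sign (s₂ - s₁)`, and let `w` be `signedRoot`. For `y ≠ 0`
the deviance depends on `y` only through `t`, the mean square over `s₁`: `2 ln L₁ = N (t - 1 - log
t)`, hence `z = σ k w(t)`. Under variance `s₂`, `t = r T` with `T` the mean square of standard
normals, whose law is free of `s₂`.

Since `w(t) = t - 1 + O((t - 1)²)` near `1`, `z` is close to `σ k (r - 1) + σ k (T - 1)`. The first
term is `√θ`; the second is asymptotically standard normal by the central limit theorem, uniformly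
in the level by Pólya's theorem. The bias of the linearisation is of order `k (r - 1)² = θ / k`,
negligible when `θ` is small compared with `√N` (`exists_forall_abs_measureReal_rootStat_sub_le`).

For larger `θ` and levels at most `C`, both distribution functions are nearly `0`: `w` is monotone,
so `z` dominates pointwise its value at a closer alternative with `√θ = K`, where the first result
applies (`exists_forall_le_abs_measureReal_rootStat_sub_le`). Squaring gives the claims on `2 ln
L₁`. -/

/-- The signed square root of `2 (t - 1 - log t)`, with the sign of `t - 1`. -/
noncomputable def signedRoot (t : ℝ) : ℝ := Real.sign (t - 1) * √(2 * (t - 1 - Real.log t))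

theorem sub_one_sub_log_nonneg {t : ℝ} (ht : 0 < t) : 0 ≤ t - 1 - Real.log t := by
  linarith [Real.log_le_sub_one_of_pos ht]

theorem signedRoot_of_one_le {t : ℝ} (ht : 1 ≤ t) :
    signedRoot t = √(2 * (t - 1 - Real.log t)) := by
  rcases ht.eq_or_lt with rfl | h
  · simp [signedRoot]
  · rw [signedRoot, Real.sign_of_pos (by linarith), one_mul]

theorem signedRoot_of_le_one {t : ℝ} (ht : t ≤ 1) :
    signedRoot t = -√(2 * (t - 1 - Real.log t)) := by
  rcases ht.eq_or_lt with rfl | h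
  · simp [signedRoot]
  · rw [signedRoot, Real.sign_of_neg (by linarith), neg_one_mul]

theorem signedRoot_sq {t : ℝ} (ht : 0 < t) :
    signedRoot t ^ 2 = 2 * (t - 1 - Real.log t) := by
  have h := sub_one_sub_log_nonneg ht
  rcases le_total 1 t with h1 | h1
  · rw [signedRoot_of_one_le h1, Real.sq_sqrt (by linarith)]
  · rw [signedRoot_of_le_one h1, neg_sq, Real.sq_sqrt (by linarith)]

theorem log_sub_log_le {a b : ℝ} (ha : 0 < a) (hb : 0 < b) :
    Real.log b - Real.log a ≤ (b - a) / a := by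
  rw [← Real.log_div hb.ne' ha.ne', sub_div, div_self ha.ne']
  exact Real.log_le_sub_one_of_pos (div_pos hb ha)

/-- `t - 1 - log t` decreases on `(0, 1]` and increases on `[1, ∞)`; the sign reverses the first
branch. -/
theorem signedRoot_monotoneOn : MonotoneOn signedRoot (Set.Ioi 0) := by
  intro a ha b hb hab
  have ha : 0 < a := ha
  have hb : 0 < b := hb
  rcases le_total 1 a with h1 | h1
  · rw [signedRoot_of_one_le h1, signedRoot_of_one_le (h1.trans hab)]
    apply Real.sqrt_le_sqrt
    have h2 := log_sub_log_le ha hb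
    have h3 : (b - a) / a ≤ b - a := div_le_self (by linarith) h1
    linarith
  · rcases le_total 1 b with h2 | h2
    · rw [signedRoot_of_le_one h1, signedRoot_of_one_le h2]
      linarith [Real.sqrt_nonneg (2 * (a - 1 - Real.log a)),
        Real.sqrt_nonneg (2 * (b - 1 - Real.log b))]
    · rw [signedRoot_of_le_one h1, signedRoot_of_le_one h2, neg_le_neg_iff]
      apply Real.sqrt_le_sqrt
      have h3 := log_sub_log_le hb ha
      have h4 : (a - b) / b ≤ a - b := by
        rw [div_le_iff₀ hb]; nlinarith
      linarith

/-- Taylor expansion of the logarithm bounds `w² - (t - 1)²` by a cubic. It factors as `(w - (t -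
1)) (w + (t - 1))`, and `w` has the sign of `t - 1`, so the second factor is at least `|t - 1|` in
size and one power cancels. -/
theorem abs_signedRoot_sub_le {t : ℝ} (ht : |t - 1| ≤ 1 / 2) :
    |signedRoot t - (t - 1)| ≤ 4 * (t - 1) ^ 2 := by
  obtain ⟨ht1, ht2⟩ := abs_le.mp ht
  have ht0 : 0 < t := by linarith
  have h := Real.abs_log_sub_add_sum_range_le (x := -(t - 1))
    (by rw [abs_neg]; linarith) 2
  simp only [Finset.sum_range_succ, Finset.sum_range_zero, abs_neg] at h
  norm_num at h
  have h1 : |t - 1| ^ 3 / (1 - |t - 1|) ≤ 2 * |t - 1| ^ 3 := by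
    rw [div_le_iff₀ (by linarith)]
    nlinarith [pow_nonneg (abs_nonneg (t - 1)) 3]
  have h2 : |signedRoot t ^ 2 - (t - 1) ^ 2| ≤ 4 * |t - 1| ^ 3 := by
    rw [signedRoot_sq ht0]
    have h3 := h.trans h1
    rw [abs_le] at h3 ⊢
    constructor <;> nlinarith
  have h4 : |t - 1| ≤ |signedRoot t + (t - 1)| := by
    rcases le_total 1 t with h1 | h1
    · rw [signedRoot_of_one_le h1, abs_of_nonneg (by linarith), abs_of_nonneg] <;>
        linarith [Real.sqrt_nonneg (2 * (t - 1 - Real.log t))]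
    · rw [signedRoot_of_le_one h1, abs_of_nonpos (by linarith), abs_of_nonpos] <;>
        linarith [Real.sqrt_nonneg (2 * (t - 1 - Real.log t))]
  rcases eq_or_ne t 1 with rfl | hne
  · simp [signedRoot]
  have hpos : 0 < |t - 1| := abs_pos.mpr (sub_ne_zero.mpr hne)
  rw [sq_sub_sq, abs_mul] at h2
  have h5 : |t - 1| * |signedRoot t - (t - 1)| ≤ |t - 1| * (4 * |t - 1| ^ 2) :=
    (mul_le_mul_of_nonneg_right h4 (abs_nonneg _)).trans (h2.trans_eq (by ring))
  rw [← sq_abs (t - 1)]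
  exact le_of_mul_le_mul_left h5 hpos

theorem measurable_realSign : Measurable Real.sign := by
  unfold Real.sign
  exact Measurable.ite measurableSet_Iio measurable_const
    (Measurable.ite measurableSet_Ioi measurable_const measurable_const)

@[fun_prop]
theorem measurable_signedRoot : Measurable signedRoot := by
  unfold signedRoot
  exact (measurable_realSign.comp (by fun_prop)).mul (by fun_prop)

/-! ### The standard normal distribution function -/

theorem gaussianReal_real_Iic (m x : ℝ) :
    (gaussianReal m 1).real (Set.Iic x) = cdf (gaussianReal 0 1) (x - m) := by
  have h : gaussianReal m 1 = (gaussianReal 0 1).map (· + m) := by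
    rw [gaussianReal_map_add_const, zero_add]
  rw [cdf_eq_real, h, map_measureReal_apply (by fun_prop) measurableSet_Iic]
  congr 1
  ext y
  simp [le_sub_iff_add_le]

/-- The density is at most `1 / √(2π) ≤ 1`, so the distribution function is 1-Lipschitz. -/
theorem cdf_gaussianReal_sub_le {a b : ℝ} (hab : a ≤ b) :
    cdf (gaussianReal 0 1) b - cdf (gaussianReal 0 1) a ≤ b - a := by
  rw [cdf_eq_real, cdf_eq_real, ← measureReal_sdiff (Set.Iic_subset_Iic.mpr hab) measurableSet_Iic,
    Set.Iic_sdiff_Iic, measureReal_def]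
  refine ENNReal.toReal_le_of_le_ofReal (by linarith) ?_
  rw [gaussianReal_apply 0 one_ne_zero, ← Real.volume_Ioc, ← setLIntegral_one]
  refine lintegral_mono fun x => ?_
  rw [gaussianPDF, ENNReal.ofReal_le_one, gaussianPDFReal]
  have h1 : (1 : ℝ) ≤ √(2 * Real.pi * (1 : NNReal)) := by
    rw [Real.one_le_sqrt]
    have := Real.two_le_pi
    push_cast
    linarith
  refine mul_le_one₀ (inv_le_one_of_one_le₀ h1) (Real.exp_pos _).le ?_
  rw [Real.exp_le_one_iff]
  exact div_nonpos_of_nonpos_of_nonneg (by nlinarith [sq_nonneg (x - 0)]) (by positivity)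

theorem exists_cdf_gaussianReal_tail {ε : ℝ} (hε : 0 < ε) :
    ∃ M : ℝ, 1 ≤ M ∧ cdf (gaussianReal 0 1) (-M) ≤ ε ∧ 1 - ε ≤ cdf (gaussianReal 0 1) M := by
  have h1 := ((tendsto_cdf_atBot (gaussianReal 0 1)).comp tendsto_neg_atTop_atBot).eventually_le_const
      hε
  have h2 := (tendsto_cdf_atTop (gaussianReal 0 1)).eventually_const_le
    (show 1 - ε < 1 by linarith)
  obtain ⟨M, hM⟩ := ((eventually_ge_atTop (1 : ℝ)).and (h1.and h2)).exists
  exact ⟨M, hM⟩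

/-- **Pólya's theorem** for a standard normal limit: pointwise convergence of distribution
functions is uniform. -/
theorem eventually_forall_abs_sub_cdf_gaussianReal_le {ι : Type*} {l : Filter ι}
    {F : ι → ℝ → ℝ} (hmono : ∀ n, Monotone (F n)) (h0 : ∀ n x, 0 ≤ F n x) (h1 : ∀ n x, F n x ≤ 1)
    (hF : ∀ x, Tendsto (fun n => F n x) l (𝓝 (cdf (gaussianReal 0 1) x))) {ε : ℝ} (hε : 0 < ε) :
    ∀ᶠ n in l, ∀ x, |F n x - cdf (gaussianReal 0 1) x| ≤ ε := by
  set Φ := cdf (gaussianReal 0 1) with hΦ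
  obtain ⟨M, hM1, hMl, hMr⟩ := exists_cdf_gaussianReal_tail (half_pos hε)
  obtain ⟨K, hK⟩ := exists_nat_gt (2 * M / (ε / 2))
  -- Pointwise convergence is used only on a finite grid of mesh `ε / 2` covering `[-M, M]`. Between
  -- neighbours the limit grows by at most `ε / 2`, and monotonicity traps `F n x`.
  have hgrid : ∀ᶠ n in l, ∀ j ∈ Finset.range (K + 1),
      |F n (-M + j * (ε / 2)) - Φ (-M + j * (ε / 2))| ≤ ε / 2 := by
    rw [eventually_all_finset]
    intro j _
    have := (tendsto_iff_norm_sub_tendsto_zero.mp (hF (-M + j * (ε / 2)))).eventually_le_const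
      (half_pos hε)
    simpa [Real.norm_eq_abs] using this
  filter_upwards [hgrid] with n hn x
  have hpt : ∀ j : ℕ, j ≤ K → |F n (-M + j * (ε / 2)) - Φ (-M + j * (ε / 2))| ≤ ε / 2 :=
    fun j hj => hn j (Finset.mem_range.mpr (by omega))
  have hΦm := monotone_cdf (gaussianReal 0 1)
  rw [← hΦ] at hΦm
  have hKM : M ≤ -M + K * (ε / 2) := by
    rw [div_lt_iff₀ (half_pos hε)] at hK
    linarith
  rcases lt_or_ge x (-M) with hx | hx
  · have h2 := abs_le.mp (hpt 0 (Nat.zero_le _))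
    simp only [Nat.cast_zero, zero_mul, add_zero] at h2
    have h3 := hmono n hx.le
    have h4 := hΦm hx.le
    have h5 := cdf_nonneg (gaussianReal 0 1) x
    rw [← hΦ] at h5
    rw [abs_le]
    constructor <;> linarith [h0 n x]
  rcases le_or_gt (-M + K * (ε / 2)) x with hx2 | hx2
  · have h2 := abs_le.mp (hpt K le_rfl)
    have h3 := hmono n hx2
    have h4 := hΦm hx2
    have h5 := cdf_le_one (gaussianReal 0 1) x
    have h6 := hΦm hKM
    rw [← hΦ] at h5
    rw [abs_le]
    constructor <;> linarith [h1 n x]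
  · have hq : 0 ≤ (x + M) / (ε / 2) := div_nonneg (by linarith) (by linarith)
    set j := ⌊(x + M) / (ε / 2)⌋₊ with hj
    have hj1 : (j : ℝ) * (ε / 2) ≤ x + M := by
      rw [← le_div_iff₀ (half_pos hε)]
      exact Nat.floor_le hq
    have hj2 : x + M < ((j : ℝ) + 1) * (ε / 2) := by
      rw [← div_lt_iff₀ (half_pos hε)]
      exact Nat.lt_floor_add_one _
    have hjK : j < K := by
      have : (j : ℝ) * (ε / 2) < K * (ε / 2) := by linarith
      exact_mod_cast lt_of_mul_lt_mul_right this (half_pos hε).le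
    have ha := abs_le.mp (hpt j hjK.le)
    have hb := abs_le.mp (hpt (j + 1) hjK)
    push_cast at hb
    have hax : -M + j * (ε / 2) ≤ x := by linarith
    have hxb : x ≤ -M + ((j : ℝ) + 1) * (ε / 2) := by linarith
    have g1 := cdf_gaussianReal_sub_le hax
    have g2 := cdf_gaussianReal_sub_le hxb
    rw [← hΦ] at g1 g2
    have g3 := hmono n hax
    have g4 := hmono n hxb
    rw [abs_le]
    constructor <;> linarith

/-! ### Moments of the standard normal distribution -/

theorem integral_sq_gaussianReal (v : NNReal) : ∫ x, x ^ 2 ∂(gaussianReal 0 v) = v := by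
  have h := variance_fun_id_gaussianReal (μ := 0) (v := v)
  rw [variance_eq_integral (by fun_prop)] at h
  simpa using h

theorem integral_pow_four_gaussianReal : ∫ x, x ^ 4 ∂(gaussianReal 0 1) = 3 := by
  have h := iteratedDeriv_mgf_zero (X := id) (μ := gaussianReal 0 1)
    (by simp [integrableExpSet_id_gaussianReal]) 4
  -- Every derivative of the moment generating function is a polynomial times `exp (t² / 2)`;
  -- differentiation sends the polynomial `p` to `p' + t p`.
  have hd : ∀ p p' : ℝ → ℝ, (∀ t, HasDerivAt p (p' t) t) →
      deriv (fun t => p t * Real.exp (t ^ 2 / 2))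
        = fun t => (p' t + t * p t) * Real.exp (t ^ 2 / 2) := by
    intro p p' hp
    funext t
    have h2 : HasDerivAt (fun t : ℝ => t ^ 2 / 2) t t := by
      simpa using ((hasDerivAt_id t).pow 2).div_const 2
    rw [((hp t).fun_mul h2.exp).deriv]
    ring
  have hmgf : mgf id (gaussianReal 0 1) = fun t => 1 * Real.exp (t ^ 2 / 2) := by
    rw [mgf_id_gaussianReal]
    simp
  rw [hmgf, iteratedDeriv_succ, iteratedDeriv_succ, iteratedDeriv_succ, iteratedDeriv_one,
    hd (fun _ => 1) (fun _ => 0) (fun t => hasDerivAt_const t 1),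
    hd (fun t => 0 + t * 1) (fun _ => 1) (fun t => by simpa using hasDerivAt_id' t),
    hd (fun t => 1 + t * (0 + t * 1)) (fun t => 2 * t) (fun t => by
      have := ((hasDerivAt_id t).pow 2).const_add 1
      convert! this using 1
      · funext s; simp; ring
      · simp),
    hd (fun t => 2 * t + t * (1 + t * (0 + t * 1))) (fun t => 3 + 3 * t ^ 2) (fun t => by
      have := ((hasDerivAt_id t).pow 3).add ((hasDerivAt_id t).const_mul 3)
      convert! this using 1
      · funext s; simp; ring
      · simp; ring)] at h
  simpa using h.symm

/-! ### The normalised mean square of a standard normal sequence -/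

/-- The law of a sequence of i.i.d. standard normal variables. -/
noncomputable abbrev stdNormalSeq : Measure (ℕ → ℝ) :=
  Measure.infinitePi fun _ => gaussianReal 0 1

/-- The mean square of the first `N` terms of a sequence. -/
noncomputable def meanSq (N : ℕ) (ω : ℕ → ℝ) : ℝ := (∑ k ∈ Finset.range N, ω k ^ 2) / N

@[fun_prop]
theorem measurable_meanSq (N : ℕ) : Measurable (meanSq N) := by
  unfold meanSq
  fun_prop

/-- Realises the samples for all `N` and all variances on one space, so that one limit theorem
serves every alternative and different alternatives can be compared pointwise. -/
theorem map_sqrt_mul_stdNormalSeq (N : ℕ) {v : ℝ} (hv : 0 ≤ v) :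
    stdNormalSeq.map (fun ω (i : Fin N) => √v * ω i) = sampleLaw N v := by
  have hind : iIndepFun (fun (i : Fin N) (ω : ℕ → ℝ) => √v * ω i) stdNormalSeq :=
    (iIndepFun_infinitePi (P := fun _ : ℕ => gaussianReal 0 1) (X := fun _ x => √v * x)
      (fun _ => by fun_prop)).precomp (g := fun i : Fin N => (i : ℕ)) Fin.val_injective
  have hm : ∀ i : Fin N, AEMeasurable (fun ω : ℕ → ℝ => √v * ω i) stdNormalSeq := fun i =>
    Measurable.aemeasurable (by fun_prop)
  rw [hind.map_fun_eq_pi_map hm, sampleLaw]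
  congr 1
  funext i
  have h : (fun ω : ℕ → ℝ => √v * ω i) = (fun x => √v * x) ∘ fun ω : ℕ → ℝ => ω i := rfl
  rw [h, ← Measure.map_map (by fun_prop) (by fun_prop), Measure.infinitePi_map_eval,
    gaussianReal_map_const_mul, mul_zero, mul_one]
  congr 1
  ext
  simp [Real.sq_sqrt hv, hv]

/-- Central limit theorem for `σ (x² - 1) / √2`, whose variance is `(3 - 2 + 1) / 2 = 1`. The sign
`σ` covers alternatives on either side of the reference variance. -/
theorem tendstoInDistribution_meanSq {σ : ℝ} (hσ : σ ^ 2 = 1) :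
    TendstoInDistribution (fun (N : ℕ) ω => σ * (√(N / 2) * (meanSq N ω - 1))) atTop id
      (fun _ => stdNormalSeq) (gaussianReal 0 1) := by
  let f : ℝ → ℝ := fun x => σ * ((x ^ 2 - 1) / √2)
  have hf : Measurable f := by fun_prop
  have hmap : ∀ i : ℕ, stdNormalSeq.map (fun ω => ω i) = gaussianReal 0 1 :=
    fun i => Measure.infinitePi_map_eval _ i
  have hint : ∀ g : ℝ → ℝ, Continuous g →
      ∫ ω, g (ω 0) ∂stdNormalSeq = ∫ x, g x ∂(gaussianReal 0 1) := fun g hg => by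
    rw [← hmap 0, integral_map (measurable_pi_apply 0).aemeasurable hg.aestronglyMeasurable]
  have hI : ∀ n : ℕ, Integrable (fun x : ℝ => x ^ n) (gaussianReal 0 1) := fun n => by
    have := (memLp_id_gaussianReal (μ := 0) (v := 1) n).integrable_norm_pow'
    refine (integrable_norm_iff (by fun_prop)).mp ?_
    simpa using this
  have h2 : ∫ x : ℝ, x ^ 2 ∂(gaussianReal 0 1) = 1 := by simpa using integral_sq_gaussianReal 1
  have key := tendstoInDistribution_inv_sqrt_mul_sum (P := stdNormalSeq)
    (X := fun i ω => f (ω i)) (Y := id) (P' := gaussianReal 0 1) HasLaw.id ?_ ?_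
    (iIndepFun_infinitePi (X := fun _ => f) fun _ => hf) ?_
  · refine key.congr (fun N => .of_forall fun ω => ?_) .rfl
    rcases Nat.eq_zero_or_pos N with rfl | hN
    · simp
    have hN' : (0 : ℝ) < N := by exact_mod_cast hN
    simp only [f, meanSq]
    rw [← Finset.mul_sum, ← Finset.sum_div, Finset.sum_sub_distrib, Real.sqrt_div hN'.le]
    simp only [Finset.sum_const, Finset.card_range, nsmul_eq_mul, mul_one]
    have hs := Real.mul_self_sqrt hN'.le
    have hs0 : 0 < √(N : ℝ) := Real.sqrt_pos.mpr hN'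
    have h20 : 0 < √(2 : ℝ) := by positivity
    generalize √(N : ℝ) = s at *
    rw [← hs]
    field_simp
  · rw [hint f (by fun_prop)]
    simp only [f]
    rw [integral_const_mul, integral_div, integral_sub (hI 2) (integrable_const _), h2]
    simp
  · change ∫ ω, f (ω 0) ^ 2 ∂stdNormalSeq = 1
    rw [hint (fun x => f x ^ 2) (by fun_prop)]
    have : ∀ x, f x ^ 2 = (x ^ 4 - 2 * x ^ 2 + 1) / 2 := fun x => by
      simp only [f]
      rw [mul_pow, hσ, div_pow, Real.sq_sqrt (by norm_num)]
      ring
    simp only [this]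
    rw [integral_div, integral_add (f := fun x : ℝ => x ^ 4 - 2 * x ^ 2)
      ((hI 4).sub ((hI 2).const_mul 2)) (integrable_const _),
      integral_sub (hI 4) ((hI 2).const_mul 2), integral_const_mul, h2,
      integral_pow_four_gaussianReal]
    simp
    norm_num
  · intro i
    have : IdentDistrib (fun ω : ℕ → ℝ => ω i) (fun ω => ω 0) stdNormalSeq stdNormalSeq :=
      ⟨(measurable_pi_apply i).aemeasurable, (measurable_pi_apply 0).aemeasurable,
        by rw [hmap, hmap]⟩
    exact this.comp hf

theorem eventually_forall_abs_measureReal_meanSq_sub_le {σ : ℝ} (hσ : σ ^ 2 = 1) {ε : ℝ}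
    (hε : 0 < ε) :
    ∀ᶠ N : ℕ in atTop, ∀ t,
      |stdNormalSeq.real {ω | σ * (√(N / 2) * (meanSq N ω - 1)) ≤ t}
        - cdf (gaussianReal 0 1) t| ≤ ε := by
  refine eventually_forall_abs_sub_cdf_gaussianReal_le
    (F := fun (N : ℕ) t => stdNormalSeq.real {ω | σ * (√(N / 2) * (meanSq N ω - 1)) ≤ t})
    (fun N a b hab => measureReal_mono fun ω hω => le_trans hω hab)
    (fun _ _ => measureReal_nonneg) (fun _ _ => measureReal_le_one) (fun t => ?_) hε
  have hn := nullSingletonClass_gaussianReal (μ := 0) (v := 1) one_ne_zero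
  have h := ProbabilityMeasure.tendsto_measure_of_null_frontier_of_tendsto'
    (tendstoInDistribution_meanSq hσ).tendsto (E := Set.Iic t)
    (by simp [Measure.map_id])
  simp only [ProbabilityMeasure.coe_mk, Measure.map_id] at h
  have h' := (ENNReal.tendsto_toReal (measure_ne_top _ _)).comp h
  rw [cdf_eq_real]
  refine h'.congr fun N => ?_
  simp only [Function.comp_apply]
  rw [Measure.map_apply (by fun_prop) measurableSet_Iic]
  rfl

/-! ### Transfer of normal approximations -/

/-- If `Z` is nearly standard normal and `X` is close to `m + Z` wherever `|Z| ≤ M`, then `X` is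
nearly normal with mean `m` and variance `1`. -/
theorem abs_measureReal_sub_cdf_le {Ω : Type*} [MeasurableSpace Ω] {P : Measure Ω}
    [IsProbabilityMeasure P] {X Z : Ω → ℝ} (hZ : Measurable Z) {m M ε η : ℝ}
    (hη : 0 ≤ η)
    (hF : ∀ t, |P.real {ω | Z ω ≤ t} - cdf (gaussianReal 0 1) t| ≤ ε)
    (hMl : cdf (gaussianReal 0 1) (-M) ≤ ε) (hMr : 1 - ε ≤ cdf (gaussianReal 0 1) M)
    (hX : ∀ ω, |Z ω| ≤ M → |X ω - (m + Z ω)| ≤ η) (b : ℝ) :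
    |P.real {ω | X ω ≤ b} - cdf (gaussianReal 0 1) (b - m)| ≤ 5 * ε + η := by
  set Φ := cdf (gaussianReal 0 1)
  -- Each tail of `Z` beyond `M` costs `2 * ε`: one for the normal tail, one for the approximation.
  -- The final bound adds one more `ε` from `hF` and `η` from the Lipschitz bound.
  have htail : P.real {ω | M < |Z ω|} ≤ 4 * ε := by
    have h1 : {ω | M < |Z ω|} ⊆ {ω | Z ω ≤ -M} ∪ {ω | Z ω ≤ M}ᶜ := by
      intro ω (hω : M < |Z ω|)
      rcases lt_abs.mp hω with h | h
      · exact Or.inr (not_le.mpr h)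
      · exact Or.inl (show Z ω ≤ -M by linarith)
    have h2 : P.real {ω | Z ω ≤ M}ᶜ = 1 - P.real {ω | Z ω ≤ M} :=
      probReal_compl_eq_one_sub (measurableSet_le hZ measurable_const)
    have h3 := (measureReal_mono (μ := P) h1).trans (measureReal_union_le _ _)
    have h4 := abs_le.mp (hF M)
    have h5 := abs_le.mp (hF (-M))
    linarith
  have hup : P.real {ω | X ω ≤ b} ≤ P.real {ω | Z ω ≤ b - m + η} + 4 * ε := by
    have h1 : {ω | X ω ≤ b} ⊆ {ω | Z ω ≤ b - m + η} ∪ {ω | M < |Z ω|} := by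
      intro ω (hω : X ω ≤ b)
      rcases le_or_gt |Z ω| M with h | h
      · have := abs_le.mp (hX ω h)
        exact Or.inl (show Z ω ≤ b - m + η by linarith)
      · exact Or.inr h
    linarith [(measureReal_mono (μ := P) h1).trans (measureReal_union_le _ _)]
  have hlow : P.real {ω | Z ω ≤ b - m - η} ≤ P.real {ω | X ω ≤ b} + 4 * ε := by
    have h1 : {ω | Z ω ≤ b - m - η} ⊆ {ω | X ω ≤ b} ∪ {ω | M < |Z ω|} := by
      intro ω (hω : Z ω ≤ b - m - η)
      rcases le_or_gt |Z ω| M with h | h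
      · have := abs_le.mp (hX ω h)
        exact Or.inl (show X ω ≤ b by linarith)
      · exact Or.inr h
    linarith [(measureReal_mono (μ := P) h1).trans (measureReal_union_le _ _)]
  have h1 := abs_le.mp (hF (b - m + η))
  have h2 := abs_le.mp (hF (b - m - η))
  have h3 : Φ (b - m + η) - Φ (b - m) ≤ b - m + η - (b - m) := cdf_gaussianReal_sub_le (by linarith)
  have h4 : Φ (b - m) - Φ (b - m - η) ≤ b - m - (b - m - η) := cdf_gaussianReal_sub_le (by linarith)
  rw [abs_le]
  constructor <;> linarith

/-- Distribution functions that agree up to level `√c` give squares whose distribution functions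
agree at level `c`. -/
theorem abs_measureReal_sq_le_sub_le {μ ν : Measure ℝ} [IsProbabilityMeasure μ]
    [IsProbabilityMeasure ν] {c ε : ℝ} (hε : 0 ≤ ε)
    (h : ∀ t ≤ √c, |μ.real (Set.Iic t) - ν.real (Set.Iic t)| ≤ ε) :
    |μ.real {x | x ^ 2 ≤ c} - ν.real {x | x ^ 2 ≤ c}| ≤ 2 * ε := by
  rcases lt_or_ge c 0 with hc | hc
  · have : {x : ℝ | x ^ 2 ≤ c} = ∅ := by
      ext x
      simp only [Set.mem_ofPred_eq, Set.mem_empty_iff_false, iff_false, not_le]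
      exact hc.trans_le (sq_nonneg x)
    simpa [this] using hε
  have hset : {x : ℝ | x ^ 2 ≤ c} = Set.Iic (√c) \ Set.Iio (-√c) := by
    ext x
    simp only [Set.mem_ofPred_eq, Set.mem_sdiff, Set.mem_Iic, Set.mem_Iio, not_lt]
    rw [Real.sq_le hc, and_comm]
  have hsub : Set.Iio (-√c) ⊆ Set.Iic (√c) := fun x hx =>
    (le_of_lt hx).trans ((neg_nonpos.mpr (Real.sqrt_nonneg c)).trans (Real.sqrt_nonneg c))
  -- The interval `[-√c, √c]` is closed on the left, so `Iio (-√c)` must be reached as a limit of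
  -- half-lines `Iic`; this avoids assuming that the measures have no atoms.
  have hlim : ∀ ρ : Measure ℝ, IsProbabilityMeasure ρ →
      Tendsto (fun n : ℕ => ρ.real (Set.Iic (-√c - 1 / ((n : ℝ) + 1)))) atTop
        (𝓝 (ρ.real (Set.Iio (-√c)))) := by
    intro ρ _
    have hU : Set.Iio (-√c) = ⋃ n : ℕ, Set.Iic (-√c - 1 / ((n : ℝ) + 1)) := by
      ext x
      simp only [Set.mem_Iio, Set.mem_iUnion, Set.mem_Iic]
      constructor
      · intro hx
        obtain ⟨n, hn⟩ := exists_nat_one_div_lt (sub_pos.mpr hx)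
        exact ⟨n, by linarith⟩
      · rintro ⟨n, hn⟩
        have : 0 < 1 / ((n : ℝ) + 1) := by positivity
        linarith
    rw [hU]
    refine (ENNReal.tendsto_toReal (measure_ne_top _ _)).comp (tendsto_measure_iUnion_atTop ?_)
    intro a b hab
    refine Set.Iic_subset_Iic.mpr (sub_le_sub_left ?_ _)
    have : (a : ℝ) ≤ b := by exact_mod_cast hab
    gcongr
  have hIio : |μ.real (Set.Iio (-√c)) - ν.real (Set.Iio (-√c))| ≤ ε := by
    refine le_of_tendsto ((hlim μ inferInstance).sub (hlim ν inferInstance)).abs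
      (.of_forall fun n => h _ ?_)
    have : 0 < 1 / ((n : ℝ) + 1) := by positivity
    linarith [Real.sqrt_nonneg c]
  rw [hset, measureReal_sdiff hsub measurableSet_Iio, measureReal_sdiff hsub measurableSet_Iio]
  have h1 := abs_le.mp (h _ le_rfl)
  have h2 := abs_le.mp hIio
  rw [abs_le]
  constructor <;> linarith

/-! ### The normal approximation of the signed root statistic -/

/-- The signed root statistic as a function of standard normal samples, where `r` is the ratio of
the true variance to the reference variance and `σ` the sign of `r - 1`. -/
noncomputable def rootStat (N : ℕ) (r σ : ℝ) (ω : ℕ → ℝ) : ℝ :=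
  σ * (√(N / 2) * signedRoot (r * meanSq N ω))

@[fun_prop]
theorem measurable_rootStat (N : ℕ) (r σ : ℝ) : Measurable (rootStat N r σ) := by
  unfold rootStat
  fun_prop

/-- Since `r T - 1 = (r - 1) + r (T - 1)`, the error is the quadratic remainder of `signedRoot` at
`r T` plus the cross term `(r - 1) k (T - 1)`. The remainder splits into a part from `T - 1` and a
bias `k (r - 1)²`; each of the three pieces gets `η / 3`. -/
theorem abs_root_sub_add_le {k r T M η : ℝ} (hk : 0 < k) (hr : |r - 1| ≤ 1 / 4)
    (hZ : |k * (T - 1)| ≤ M) (hkM : 8 * M ≤ k) (h1 : |r - 1| * M ≤ η / 3)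
    (h2 : 32 * M ^ 2 / k ≤ η / 3) (h3 : 8 * (k * (r - 1) ^ 2) ≤ η / 3) :
    |k * signedRoot (r * T) - (k * (r - 1) + k * (T - 1))| ≤ η := by
  have hT : |T - 1| ≤ M / k := by
    rw [abs_mul, abs_of_pos hk] at hZ
    rw [le_div_iff₀ hk, mul_comm]
    exact hZ
  have hMk : M / k ≤ 1 / 8 := by
    rw [div_le_iff₀ hk]; linarith
  have hr2 : |r| ≤ 2 := by
    obtain ⟨h, h'⟩ := abs_le.mp hr
    rw [abs_le]; constructor <;> linarith
  have hu : |r * T - 1| ≤ |r - 1| + 2 * (M / k) := by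
    have : r * T - 1 = (r - 1) + r * (T - 1) := by ring
    rw [this]
    refine (abs_add_le _ _).trans ?_
    rw [abs_mul]
    gcongr
  -- `|r T - 1| ≤ 1/4 + 2 * (1/8)`, exactly the radius in which the linearisation holds.
  have hw := abs_signedRoot_sub_le (t := r * T) (by linarith)
  have hsq : (r * T - 1) ^ 2 ≤ 2 * (r - 1) ^ 2 + 8 * (M / k) ^ 2 := by
    rw [← sq_abs (r * T - 1), ← sq_abs (r - 1)]
    have : |r * T - 1| ^ 2 ≤ (|r - 1| + 2 * (M / k)) ^ 2 := by gcongr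
    nlinarith [sq_nonneg (|r - 1| - 2 * (M / k))]
  have heq : k * signedRoot (r * T) - (k * (r - 1) + k * (T - 1))
      = k * (signedRoot (r * T) - (r * T - 1)) + (r - 1) * (k * (T - 1)) := by ring
  rw [heq]
  have e1 : |k * (signedRoot (r * T) - (r * T - 1))|
      ≤ 8 * (k * (r - 1) ^ 2) + 32 * M ^ 2 / k := by
    rw [abs_mul, abs_of_pos hk]
    calc k * |signedRoot (r * T) - (r * T - 1)|
        ≤ k * (4 * (2 * (r - 1) ^ 2 + 8 * (M / k) ^ 2)) := by
          gcongr; linarith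
      _ = _ := by field_simp; ring
  have e2 : |(r - 1) * (k * (T - 1))| ≤ |r - 1| * M := by
    rw [abs_mul]
    gcongr
  linarith [abs_add_le (k * (signedRoot (r * T) - (r * T - 1))) ((r - 1) * (k * (T - 1)))]

theorem exists_forall_abs_measureReal_rootStat_sub_le {ε : ℝ} (hε : 0 < ε) :
    ∃ δ : ℝ, 0 < δ ∧ ∃ N₀ : ℕ, ∀ N : ℕ, N₀ ≤ N → ∀ r σ : ℝ, σ = 1 ∨ σ = -1 →
      (r - 1) ^ 2 * (N / 2) ≤ δ * √N → ∀ c : ℝ,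
      |stdNormalSeq.real {ω | rootStat N r σ ω ≤ c}
        - cdf (gaussianReal 0 1) (c - σ * (√(N / 2) * (r - 1)))| ≤ ε := by
  -- `5 * (ε / 10) + ε / 2 = ε` in the transfer bound.
  have hε' : 0 < ε / 10 := by positivity
  obtain ⟨M, hM1, hMl, hMr⟩ := exists_cdf_gaussianReal_tail hε'
  set η := ε / 2 with hη
  have hη0 : 0 < η := by positivity
  have hM0 : 0 < M := by linarith
  set τ := min (1 / 4) (η / (3 * M)) with hτ
  have hτ0 : 0 < τ := by positivity
  -- As `√N ≤ 2k`, the hypothesis gives `k (r - 1)² ≤ 2 * δ`, so the bias is at most `16 * δ = η /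
  -- 3`.
  set δ := η / 48 with hδ
  have hδ0 : 0 < δ := by positivity
  have hk : Tendsto (fun N : ℕ => √((N : ℝ) / 2)) atTop atTop :=
    Real.tendsto_sqrt_atTop.comp (tendsto_natCast_atTop_atTop.atTop_div_const (by norm_num))
  -- The thresholds on `k` secure, in turn, the linearisation radius, the remainder from `T - 1`,
  -- and `|r - 1| ≤ τ`.
  have hev : ∀ᶠ N : ℕ in atTop,
      8 * M ≤ √((N : ℝ) / 2) ∧ 96 * M ^ 2 / η ≤ √((N : ℝ) / 2) ∧
        2 * δ / τ ^ 2 ≤ √((N : ℝ) / 2) :=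
    (hk.eventually_ge_atTop _).and ((hk.eventually_ge_atTop _).and (hk.eventually_ge_atTop _))
  obtain ⟨N₀, hN₀⟩ := eventually_atTop.mp (hev.and
    ((eventually_forall_abs_measureReal_meanSq_sub_le (σ := 1) (by norm_num) hε').and
      (eventually_forall_abs_measureReal_meanSq_sub_le (σ := -1) (by norm_num) hε')))
  refine ⟨δ, hδ0, N₀, fun N hN r σ hσ hr c => ?_⟩
  obtain ⟨⟨hk1, hk2, hk3⟩, hp, hm⟩ := hN₀ N hN
  have hF : ∀ t, |stdNormalSeq.real {ω | σ * (√(N / 2) * (meanSq N ω - 1)) ≤ t}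
      - cdf (gaussianReal 0 1) t| ≤ ε / 10 := by
    rcases hσ with rfl | rfl
    exacts [hp, hm]
  have hσabs : |σ| = 1 := by rcases hσ with rfl | rfl <;> simp
  have hk0 : 0 < √((N : ℝ) / 2) := by linarith
  have hkk : √((N : ℝ) / 2) * √((N : ℝ) / 2) = N / 2 := Real.mul_self_sqrt (by positivity)
  have hsN : √(N : ℝ) ≤ 2 * √((N : ℝ) / 2) := by
    rw [Real.sqrt_le_left (by positivity), mul_pow, Real.sq_sqrt (by positivity)]
    linarith [(Nat.cast_nonneg N : (0 : ℝ) ≤ N)]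
  set k := √((N : ℝ) / 2) with hkdef
  have hkd : k * (r - 1) ^ 2 ≤ 2 * δ := by
    rw [← hkk] at hr
    have h1 : k * (k * (r - 1) ^ 2) ≤ k * (2 * δ) := by nlinarith
    exact le_of_mul_le_mul_left h1 hk0
  have hd : |r - 1| ≤ τ := by
    apply abs_le_of_sq_le_sq _ hτ0.le
    rw [div_le_iff₀ (by positivity)] at hk3
    have h1 : k * (r - 1) ^ 2 ≤ k * τ ^ 2 := hkd.trans hk3
    exact le_of_mul_le_mul_left h1 hk0
  have hdM : |r - 1| * M ≤ η / 3 := by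
    have h1 : |r - 1| ≤ η / (3 * M) := hd.trans (min_le_right _ _)
    rw [le_div_iff₀ (by positivity)] at h1
    linarith
  have hMk : 32 * M ^ 2 / k ≤ η / 3 := by
    rw [div_le_iff₀ hη0] at hk2
    rw [div_le_iff₀ hk0]
    linarith
  have h := abs_measureReal_sub_cdf_le (P := stdNormalSeq) (X := rootStat N r σ)
    (Z := fun ω => σ * (k * (meanSq N ω - 1))) (m := σ * (k * (r - 1))) (M := M) (ε := ε / 10)
    (η := η) (by fun_prop) hη0.le hF hMl hMr (fun ω hω => ?_) c
  · exact h.trans_eq (by rw [hη]; ring)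
  · rw [abs_mul, hσabs, one_mul] at hω
    have h1 := abs_root_sub_add_le hk0 (hd.trans (min_le_left _ _)) hω hk1 hdM hMk
      (by linarith)
    have h2 : rootStat N r σ ω - (σ * (k * (r - 1)) + σ * (k * (meanSq N ω - 1)))
        = σ * (k * signedRoot (r * meanSq N ω) - (k * (r - 1) + k * (meanSq N ω - 1))) := by
      rw [rootStat]; ring
    rw [h2, abs_mul, hσabs, one_mul]
    exact h1

theorem rootStat_le_rootStat (N : ℕ) {r r' σ : ℝ} (hr : 0 < r) (hr' : 0 < r')
    (h : (σ = 1 ∧ r' ≤ r) ∨ (σ = -1 ∧ r ≤ r')) (ω : ℕ → ℝ) :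
    rootStat N r' σ ω ≤ rootStat N r σ ω := by
  have hT : 0 ≤ meanSq N ω := div_nonneg (Finset.sum_nonneg fun _ _ => sq_nonneg _) (by positivity)
  rcases hT.eq_or_lt with hT | hT
  -- A zero mean square lies outside the range of monotonicity, but there the statistic does not
  -- depend on `r`.
  · simp [rootStat, ← hT]
  have hmono : ∀ a b : ℝ, 0 < a → 0 < b → a ≤ b →
      √(N / 2) * signedRoot (a * meanSq N ω) ≤ √(N / 2) * signedRoot (b * meanSq N ω) :=
    fun a b ha hb hab => mul_le_mul_of_nonneg_left
      (signedRoot_monotoneOn (mul_pos ha hT) (mul_pos hb hT)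
        (mul_le_mul_of_nonneg_right hab hT.le)) (Real.sqrt_nonneg _)
  unfold rootStat
  rcases h with ⟨rfl, h⟩ | ⟨rfl, h⟩
  · linarith [hmono _ _ hr' hr h]
  · linarith [hmono _ _ hr hr' h]

theorem exists_forall_le_abs_measureReal_rootStat_sub_le (C : ℝ) {ε : ℝ} (hε : 0 < ε) :
    ∃ N₀ : ℕ, ∀ N : ℕ, N₀ ≤ N → ∀ r σ : ℝ, 0 < r → (σ = 1 ∧ 1 < r) ∨ (σ = -1 ∧ r < 1) →
      ∀ c ≤ C, |stdNormalSeq.real {ω | rootStat N r σ ω ≤ c}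
        - cdf (gaussianReal 0 1) (c - σ * (√(N / 2) * (r - 1)))| ≤ ε := by
  obtain ⟨δ, hδ, N₁, hN₁⟩ := exists_forall_abs_measureReal_rootStat_sub_le (half_pos hε)
  obtain ⟨M, hM1, hM, -⟩ := exists_cdf_gaussianReal_tail (half_pos hε)
  set Φ := cdf (gaussianReal 0 1) with hΦ
  have hΦm : Monotone Φ := monotone_cdf _
  -- `K ≥ C + M` puts `C - K` in the lower normal tail.
  set K := max 1 (C + M) with hK
  have hK0 : 0 < K := by positivity
  have hCK : Φ (C - K) ≤ ε / 2 :=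
    (hΦm (by linarith [le_max_right 1 (C + M)])).trans hM
  have hk : Tendsto (fun N : ℕ => √((N : ℝ) / 2)) atTop atTop :=
    Real.tendsto_sqrt_atTop.comp (tendsto_natCast_atTop_atTop.atTop_div_const (by norm_num))
  have hs : Tendsto (fun N : ℕ => δ * √(N : ℝ)) atTop atTop :=
    (Real.tendsto_sqrt_atTop.comp tendsto_natCast_atTop_atTop).const_mul_atTop hδ
  obtain ⟨N₂, hN₂⟩ := eventually_atTop.mp
    ((hk.eventually_gt_atTop K).and (hs.eventually_ge_atTop (K ^ 2)))
  refine ⟨max N₁ N₂, fun N hN r σ hr hσ c hc => ?_⟩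
  obtain ⟨hkK, hδK⟩ := hN₂ N ((le_max_right _ _).trans hN)
  have hcore := hN₁ N ((le_max_left _ _).trans hN)
  have hkk : √((N : ℝ) / 2) ^ 2 = N / 2 := Real.sq_sqrt (by positivity)
  have hk0 : 0 < √((N : ℝ) / 2) := hK0.trans hkK
  have hσ' : σ = 1 ∨ σ = -1 := hσ.imp And.left And.left
  have hσσ : σ * σ = 1 := by rcases hσ' with rfl | rfl <;> norm_num
  set k := √((N : ℝ) / 2) with hkdef
  rcases le_or_gt (σ * (k * (r - 1))) K with h | h
  · have hnn : 0 ≤ σ * (k * (r - 1)) := by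
      rcases hσ with ⟨rfl, h1⟩ | ⟨rfl, h1⟩ <;> nlinarith
    have h2 : (σ * (k * (r - 1))) ^ 2 ≤ K ^ 2 := by gcongr
    refine (hcore r σ hσ' ?_ c).trans (half_le_self hε.le)
    rw [← hkk]
    have h3 : (σ * (k * (r - 1))) ^ 2 = (σ * σ) * ((r - 1) ^ 2 * k ^ 2) := by ring
    rw [h3, hσσ] at h2
    linarith
  -- Here `√θ > K`. The comparison ratio `1 + σ K / k` lies between `1` and `r` and has `√θ = K`; `K
  -- < k` keeps it positive when `σ = -1`.
  · have hKk : K / k < 1 := (div_lt_one hk0).mpr hkK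
    have hKk0 : 0 < K / k := by positivity
    have hkr : k * (K / k) = K := by field_simp
    have hr'0 : 0 < 1 + σ * (K / k) := by
      rcases hσ' with rfl | rfl <;> linarith
    have hle : ∀ ω, rootStat N (1 + σ * (K / k)) σ ω ≤ rootStat N r σ ω :=
      rootStat_le_rootStat N hr hr'0 <| by
        rcases hσ with ⟨rfl, h1⟩ | ⟨rfl, h1⟩
        · refine Or.inl ⟨rfl, ?_⟩
          have : K / k ≤ r - 1 := by rw [div_le_iff₀ hk0]; linarith
          linarith
        · refine Or.inr ⟨rfl, ?_⟩
          have : K / k ≤ 1 - r := by rw [div_le_iff₀ hk0]; linarith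
          linarith
    have h1 := hcore (1 + σ * (K / k)) σ hσ' (by
      rw [← hkk]
      have : (1 + σ * (K / k) - 1) ^ 2 * k ^ 2 = (σ * σ) * (k * (K / k)) ^ 2 := by ring
      rw [this, hσσ, hkr]
      linarith) C
    have h2 : σ * (k * (1 + σ * (K / k) - 1)) = K := by
      have : σ * (k * (1 + σ * (K / k) - 1)) = (σ * σ) * (k * (K / k)) := by ring
      rw [this, hσσ, hkr, one_mul]
    rw [h2] at h1
    have h3 : stdNormalSeq.real {ω | rootStat N r σ ω ≤ c}
        ≤ stdNormalSeq.real {ω | rootStat N (1 + σ * (K / k)) σ ω ≤ C} :=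
      measureReal_mono fun ω hω => (hle ω).trans (le_trans hω hc)
    have h4 : Φ (c - σ * (k * (r - 1))) ≤ Φ (C - K) := hΦm (by linarith)
    have h5 : 0 ≤ Φ (c - σ * (k * (r - 1))) := cdf_nonneg _ _
    have h6 : 0 ≤ stdNormalSeq.real {ω | rootStat N r σ ω ≤ c} := measureReal_nonneg
    have h7 := abs_le.mp h1
    rw [abs_le]
    constructor <;> linarith

/-! ### The Fisher information -/

/-- The closed form fails off `v > 0`, where `toNNReal` truncates; agreement near `v` is enough for
derivatives. -/
theorem eventuallyEq_log_likelihood {N : ℕ} (y : Fin N → ℝ) {v : ℝ} (hv : 0 < v) :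
    (fun u => Real.log (likelihood y u)) =ᶠ[𝓝 v]
      fun u => -(N / 2 * Real.log (2 * Real.pi * u)) - (∑ i, y i ^ 2) / (2 * u) := by
  filter_upwards [lt_mem_nhds hv] with u hu using log_likelihood y hu

theorem contDiffAt_log_likelihood {N : ℕ} (y : Fin N → ℝ) {v : ℝ} (hv : 0 < v) {n : WithTop ℕ∞} :
    ContDiffAt ℝ n (fun u => Real.log (likelihood y u)) v := by
  refine ContDiffAt.congr_of_eventuallyEq ?_ (eventuallyEq_log_likelihood y hv)
  have h1 : 2 * Real.pi * v ≠ 0 := by positivity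
  have h2 : 2 * v ≠ 0 := by positivity
  exact ((contDiffAt_const.mul ((contDiffAt_const.mul contDiffAt_id).log h1)).neg).sub
    (contDiffAt_const.div (contDiffAt_const.mul contDiffAt_id) h2)

theorem logLikelihoodSecondDeriv_eq {N : ℕ} (y : Fin N → ℝ) {v : ℝ} (hv : 0 < v) :
    logLikelihoodSecondDeriv y v = N / (2 * v ^ 2) - (∑ i, y i ^ 2) / v ^ 3 := by
  set S := ∑ i, y i ^ 2 with hS
  have h1 : ∀ u : ℝ, 0 < u →
      deriv (fun u => Real.log (likelihood y u)) u = -(N / 2) * u⁻¹ + S / 2 * (u ^ 2)⁻¹ := by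
    intro u hu
    rw [(eventuallyEq_log_likelihood y hu).deriv_eq]
    have hlin : ∀ a : ℝ, HasDerivAt (fun u : ℝ => a * u) a u := fun a => by
      simpa using (hasDerivAt_id' u).const_mul a
    have hd := ((((hlin (2 * Real.pi)).log (by positivity)).const_mul ((N : ℝ) / 2)).fun_neg).fun_sub
      ((hasDerivAt_const u S).fun_div (hlin 2) (by positivity))
    rw [hd.deriv]
    field_simp
    ring
  have h2 : deriv (fun u => Real.log (likelihood y u)) =ᶠ[𝓝 v]
      fun u => -(N / 2) * u⁻¹ + S / 2 * (u ^ 2)⁻¹ := by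
    filter_upwards [lt_mem_nhds hv] with u hu using h1 u hu
  rw [logLikelihoodSecondDeriv, iteratedDeriv_succ, iteratedDeriv_one, h2.deriv_eq]
  have hd := ((hasDerivAt_inv hv.ne').const_mul (-((N : ℝ) / 2))).fun_add
    (((hasDerivAt_pow 2 v).fun_inv (by positivity)).const_mul (S / 2))
  rw [hd.deriv]
  field_simp
  ring

theorem integrable_eval_sq_sampleLaw {N : ℕ} (v : ℝ) (i : Fin N) :
    Integrable (fun y : Fin N → ℝ => y i ^ 2) (sampleLaw N v) := by
  have h : Integrable (fun x : ℝ => x ^ 2) (gaussianReal 0 v.toNNReal) := by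
    simpa using (memLp_id_gaussianReal (μ := 0) (v := v.toNNReal) 2).integrable_sq
  exact integrable_comp_eval (μ := fun _ : Fin N => gaussianReal 0 v.toNNReal) (i := i) h

theorem integrable_logLikelihoodSecondDeriv (N : ℕ) {v : ℝ} (hv : 0 < v) :
    Integrable (fun y : Fin N → ℝ => logLikelihoodSecondDeriv y v) (sampleLaw N v) := by
  have : IsProbabilityMeasure (sampleLaw N v) := by unfold sampleLaw; infer_instance
  simp only [logLikelihoodSecondDeriv_eq _ hv]
  exact (integrable_const _).sub
    ((integrable_finsetSum _ fun i _ => integrable_eval_sq_sampleLaw v i).div_const _)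

theorem fisherInfo_eq (N : ℕ) {v : ℝ} (hv : 0 < v) : fisherInfo N v = N / (2 * v ^ 2) := by
  have : IsProbabilityMeasure (sampleLaw N v) := by unfold sampleLaw; infer_instance
  have hI := fun i : Fin N => integrable_eval_sq_sampleLaw v i
  have h1 : ∀ i : Fin N, ∫ y, y i ^ 2 ∂(sampleLaw N v) = v := fun i => by
    have h := integral_comp_eval (μ := fun _ : Fin N => gaussianReal 0 v.toNNReal) (i := i)
      (f := fun x : ℝ => x ^ 2) (by fun_prop)
    rw [sampleLaw, h, integral_sq_gaussianReal, Real.coe_toNNReal _ hv.le]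
  simp only [fisherInfo, logLikelihoodSecondDeriv_eq _ hv]
  rw [integral_sub (integrable_const _) ((integrable_finsetSum _ fun i _ => hI i).div_const _),
    integral_div, integral_div, integral_finsetSum _ fun i _ => hI i]
  simp only [h1, integral_const, probReal_univ, smul_eq_mul, one_mul, Finset.sum_const,
    Finset.card_univ, Fintype.card_fin, nsmul_eq_mul]
  field_simp
  ring

theorem noncentrality_eq (N : ℕ) {s₁ : ℝ} (hs₁ : 0 < s₁) (s₂ : ℝ) :
    noncentrality N s₁ s₂ = (s₂ / s₁ - 1) ^ 2 * (N / 2) := by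
  rw [noncentrality, fisherInfo_eq N hs₁]
  field_simp

theorem sqrt_noncentrality (N : ℕ) {s₁ : ℝ} (hs₁ : 0 < s₁) (s₂ : ℝ) :
    √(noncentrality N s₁ s₂) = |s₂ / s₁ - 1| * √(N / 2) := by
  rw [noncentrality_eq N hs₁, Real.sqrt_mul (sq_nonneg _), Real.sqrt_sq_eq_abs]

/-! ### The likelihood ratio statistics -/

theorem realSign_mul_of_pos {a : ℝ} (ha : 0 < a) (x : ℝ) : Real.sign (a * x) = Real.sign x := by
  rcases lt_trichotomy x 0 with h | rfl | h
  · rw [Real.sign_of_neg h, Real.sign_of_neg (mul_neg_of_pos_of_neg ha h)]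
  · simp
  · rw [Real.sign_of_pos h, Real.sign_of_pos (mul_pos ha h)]

theorem realSign_mul (a x : ℝ) : Real.sign (a * x) = Real.sign a * Real.sign x := by
  rcases lt_trichotomy a 0 with h | rfl | h
  · rw [← neg_mul_neg, realSign_mul_of_pos (neg_pos.mpr h), Real.sign_neg, Real.sign_of_neg h,
      neg_one_mul]
  · simp
  · rw [realSign_mul_of_pos h, Real.sign_of_pos h, one_mul]

theorem mean_sq_pos {N : ℕ} {y : Fin N → ℝ} (hy : y ≠ 0) : 0 < (∑ i, y i ^ 2) / (N : ℝ) := by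
  rw [← varianceMLE_eq hy]
  exact ((isVarianceMLE_iff hy _).mpr (varianceMLE_eq hy)).1

theorem two_mul_log_L1 {N : ℕ} {y : Fin N → ℝ} (hy : y ≠ 0) {s₁ : ℝ} (hs₁ : 0 < s₁) :
    2 * Real.log (L1 s₁ y)
      = N / 2 * (2 * ((∑ i, y i ^ 2) / N / s₁ - 1 - Real.log ((∑ i, y i ^ 2) / N / s₁))) := by
  have hm := mean_sq_pos hy
  -- `x / 0 = 0`, so a positive mean square excludes `N = 0`.
  have hN : (N : ℝ) ≠ 0 := fun h => by simp [h] at hm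
  rw [L1, varianceMLE_eq hy, Real.log_div (likelihood_pos y hm).ne' (likelihood_pos y hs₁).ne',
    log_likelihood y hm, log_likelihood y hs₁]
  have hS : ∑ i, y i ^ 2 = N * ((∑ i, y i ^ 2) / N) := by field_simp
  generalize (∑ i, y i ^ 2) / (N : ℝ) = m at *
  rw [hS, Real.log_mul (by positivity) hm.ne', Real.log_mul (by positivity) hs₁.ne',
    Real.log_div hm.ne' hs₁.ne']
  field_simp
  ring

theorem zStat_eq {N : ℕ} {y : Fin N → ℝ} (hy : y ≠ 0) {s₁ : ℝ} (hs₁ : 0 < s₁) (s₂ : ℝ) :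
    zStat s₁ s₂ y
      = Real.sign (s₂ - s₁) * (√(N / 2) * signedRoot ((∑ i, y i ^ 2) / N / s₁)) := by
  have h : (∑ i, y i ^ 2) / N - s₁ = s₁ * ((∑ i, y i ^ 2) / N / s₁ - 1) := by field_simp
  rw [zStat, two_mul_log_L1 hy hs₁, varianceMLE_eq hy, Real.sqrt_mul (by positivity), realSign_mul,
    h, realSign_mul_of_pos hs₁, signedRoot]
  ring

theorem zStat_sq {N : ℕ} {y : Fin N → ℝ} (hy : y ≠ 0) {s₁ s₂ : ℝ} (hs₁ : 0 < s₁) (hs : s₂ ≠ s₁) :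
    zStat s₁ s₂ y ^ 2 = 2 * Real.log (L1 s₁ y) := by
  have hσ : Real.sign (s₂ - s₁) ^ 2 = 1 := by
    rcases Real.sign_apply_eq_of_ne_zero _ (sub_ne_zero.mpr hs) with h | h <;> rw [h] <;> norm_num
  rw [zStat_eq hy hs₁, two_mul_log_L1 hy hs₁, mul_pow, hσ, mul_pow, Real.sq_sqrt (by positivity),
    signedRoot_sq (div_pos (mean_sq_pos hy) hs₁), one_mul]

theorem ae_ne_zero_sampleLaw {N : ℕ} (hN : 1 ≤ N) {v : ℝ} (hv : 0 < v) :
    ∀ᵐ y ∂(sampleLaw N v), y ≠ 0 := by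
  have : NullSingletonClass (gaussianReal 0 v.toNNReal) :=
    nullSingletonClass_gaussianReal (by simpa using hv)
  filter_upwards [Measure.ae_eval_ne (μ := fun _ : Fin N => gaussianReal 0 v.toNNReal)
    ⟨0, hN⟩ (0 : ℝ)] with y hy h
  exact hy (congrFun h _)

/-- The estimate is an arbitrary choice at `y = 0`, so `zStat` is first replaced almost everywhere
by the explicit measurable function `g`. -/
theorem measureReal_zStat_mem {N : ℕ} (hN : 1 ≤ N) {s₁ s₂ : ℝ} (hs₁ : 0 < s₁) (hs₂ : 0 < s₂)
    {B : Set ℝ} (hB : MeasurableSet B) :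
    (sampleLaw N s₂).real {y | zStat s₁ s₂ y ∈ B}
      = (stdNormalSeq.map (rootStat N (s₂ / s₁) (Real.sign (s₂ - s₁)))).real B := by
  let g : (Fin N → ℝ) → ℝ := fun y =>
    Real.sign (s₂ - s₁) * (√(N / 2) * signedRoot ((∑ i, y i ^ 2) / N / s₁))
  have hg : Measurable g := by fun_prop
  have h1 : {y : Fin N → ℝ | zStat s₁ s₂ y ∈ B} =ᵐ[sampleLaw N s₂] g ⁻¹' B := by
    filter_upwards [ae_ne_zero_sampleLaw hN hs₂] with y hy
    exact congrArg (· ∈ B) (zStat_eq hy hs₁ s₂)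
  rw [measureReal_congr h1, ← map_sqrt_mul_stdNormalSeq N hs₂.le,
    map_measureReal_apply (by fun_prop) (hg hB), map_measureReal_apply (by fun_prop) hB]
  congr 1
  ext ω
  have h2 : g (fun i : Fin N => √s₂ * ω i)
      = rootStat N (s₂ / s₁) (Real.sign (s₂ - s₁)) ω := by
    simp only [g, rootStat, meanSq, mul_pow, Real.sq_sqrt hs₂.le, ← Finset.mul_sum,
      Fin.sum_univ_eq_sum_range (fun i => ω i ^ 2) N]
    congr 3
    ring
  simp only [Set.mem_preimage, h2]

/-- Both claims reduce to the law of `rootStat`, since `σ k (r - 1) = √θ`. The claim on `z` needs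
level `c`, the one on its square all levels up to `√c`; squaring doubles the error, hence `ε / 2`.
-/
theorem abs_statistics_sub_le {N : ℕ} (hN : 1 ≤ N) {s₁ s₂ : ℝ} (hs₁ : 0 < s₁) (hs₂ : 0 < s₂)
    (hs : s₂ ≠ s₁) {ε c : ℝ} (hε : 0 ≤ ε)
    (h : ∀ t ≤ max c √c,
      |stdNormalSeq.real {ω | rootStat N (s₂ / s₁) (Real.sign (s₂ - s₁)) ω ≤ t}
        - cdf (gaussianReal 0 1) (t - Real.sign (s₂ - s₁) * (√(N / 2) * (s₂ / s₁ - 1)))|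
        ≤ ε / 2) :
    |(sampleLaw N s₂).real {y | 2 * Real.log (L1 s₁ y) ≤ c}
        - (noncentralChiSqOne (noncentrality N s₁ s₂)).real (Set.Iic c)| ≤ ε ∧
      |(sampleLaw N s₂).real {y | zStat s₁ s₂ y ≤ c}
        - (gaussianReal (√(noncentrality N s₁ s₂)) 1).real (Set.Iic c)| ≤ ε := by
  set σ := Real.sign (s₂ - s₁) with hσ
  set ρ := stdNormalSeq.map (rootStat N (s₂ / s₁) σ) with hρ
  have : IsProbabilityMeasure ρ := Measure.isProbabilityMeasure_map (by fun_prop)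
  have hmean : σ * (√(N / 2) * (s₂ / s₁ - 1)) = √(noncentrality N s₁ s₂) := by
    rw [sqrt_noncentrality N hs₁]
    rcases hs.lt_or_gt with h1 | h1
    · have : s₂ / s₁ < 1 := (div_lt_one hs₁).mpr h1
      rw [hσ, Real.sign_of_neg (by linarith), abs_of_neg (by linarith)]
      ring
    · have : 1 < s₂ / s₁ := (one_lt_div hs₁).mpr h1
      rw [hσ, Real.sign_of_pos (by linarith), abs_of_pos (by linarith)]
      ring
  have hlaw : ∀ t ≤ max c √c, |ρ.real (Set.Iic t)
      - (gaussianReal (√(noncentrality N s₁ s₂)) 1).real (Set.Iic t)| ≤ ε / 2 := by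
    intro t ht
    rw [gaussianReal_real_Iic, ← hmean, hρ, map_measureReal_apply (by fun_prop) measurableSet_Iic]
    exact h t ht
  have hsq : MeasurableSet {x : ℝ | x ^ 2 ≤ c} := measurableSet_le (by fun_prop) (by fun_prop)
  constructor
  · have h1 : {y : Fin N → ℝ | 2 * Real.log (L1 s₁ y) ≤ c}
        =ᵐ[sampleLaw N s₂] {y | zStat s₁ s₂ y ∈ {x : ℝ | x ^ 2 ≤ c}} := by
      filter_upwards [ae_ne_zero_sampleLaw hN hs₂] with y hy
      exact congrArg (· ≤ c) (zStat_sq hy hs₁ hs).symm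
    rw [measureReal_congr h1, measureReal_zStat_mem hN hs₁ hs₂ hsq, noncentralChiSqOne,
      map_measureReal_apply (by fun_prop) measurableSet_Iic]
    refine (abs_measureReal_sq_le_sub_le (ε := ε / 2) (by linarith) fun t ht => hlaw t
      (ht.trans (le_max_right _ _))).trans_eq (by ring)
  · have h1 := measureReal_zStat_mem hN hs₁ hs₂ (measurableSet_Iic (a := c))
    simp only [Set.mem_Iic] at h1
    rw [h1]
    exact (hlaw c (le_max_left _ _)).trans (by linarith)

end SpectrumMisuse

theorem proposition2 (s₀ s₁ : ℝ) (hs₀ : 0 < s₀) (hs₀₁ : s₀ < s₁) :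
    -- the Fisher information of the sample at `σ₁²` exists and equals `N / (2 σ₁⁴)`
    (∀ N : ℕ,
      (∀ y : Fin N → ℝ,
        ContDiffAt ℝ 2 (fun u => Real.log (SpectrumMisuse.likelihood y u)) s₁) ∧
      MeasureTheory.Integrable
        (fun y : Fin N → ℝ => SpectrumMisuse.logLikelihoodSecondDeriv y s₁)
        (SpectrumMisuse.sampleLaw N s₁) ∧
      SpectrumMisuse.fisherInfo N s₁ = N / (2 * s₁ ^ 2)) ∧
    -- the value of `√θ`
    (∀ N : ℕ, ∀ s₂ ∈ SpectrumMisuse.hypothesisH2 s₀ s₁,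
      √(SpectrumMisuse.noncentrality N s₁ s₂) = |s₂ / s₁ - 1| * √(N / 2)) ∧
    -- `z` is a square root of `2 ln L₁`
    (∀ N : ℕ, 1 ≤ N → ∀ s₂ ∈ SpectrumMisuse.hypothesisH2 s₀ s₁,
      ∀ᵐ y ∂(SpectrumMisuse.sampleLaw N s₂),
        SpectrumMisuse.zStat s₁ s₂ y ^ 2 = 2 * Real.log (SpectrumMisuse.L1 s₁ y)) ∧
    -- for large `N`, the distribution functions agree up to any fixed level,
    -- uniformly over the whole of `H₂`
    (∀ C : ℝ, ∀ ε : ℝ, 0 < ε → ∃ N₀ : ℕ, ∀ N : ℕ, N₀ ≤ N →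
      ∀ s₂ ∈ SpectrumMisuse.hypothesisH2 s₀ s₁, ∀ c : ℝ, c ≤ C →
        |(SpectrumMisuse.sampleLaw N s₂).real
              {y | 2 * Real.log (SpectrumMisuse.L1 s₁ y) ≤ c}
            - (SpectrumMisuse.noncentralChiSqOne
                (SpectrumMisuse.noncentrality N s₁ s₂)).real (Set.Iic c)| ≤ ε ∧
        |(SpectrumMisuse.sampleLaw N s₂).real {y | SpectrumMisuse.zStat s₁ s₂ y ≤ c}
            - (ProbabilityTheory.gaussianReal
                (√(SpectrumMisuse.noncentrality N s₁ s₂)) 1).real (Set.Iic c)| ≤ ε) ∧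
    -- for large `N`, the distribution functions agree at all levels,
    -- uniformly over the part of `H₂` where `θ` is small compared with `√N`
    (∀ ε : ℝ, 0 < ε → ∃ δ : ℝ, 0 < δ ∧ ∃ N₀ : ℕ, ∀ N : ℕ, N₀ ≤ N →
      ∀ s₂ ∈ SpectrumMisuse.hypothesisH2 s₀ s₁,
        SpectrumMisuse.noncentrality N s₁ s₂ ≤ δ * √N → ∀ c : ℝ,
        |(SpectrumMisuse.sampleLaw N s₂).real
              {y | 2 * Real.log (SpectrumMisuse.L1 s₁ y) ≤ c}
            - (SpectrumMisuse.noncentralChiSqOne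
                (SpectrumMisuse.noncentrality N s₁ s₂)).real (Set.Iic c)| ≤ ε ∧
        |(SpectrumMisuse.sampleLaw N s₂).real {y | SpectrumMisuse.zStat s₁ s₂ y ≤ c}
            - (ProbabilityTheory.gaussianReal
                (√(SpectrumMisuse.noncentrality N s₁ s₂)) 1).real (Set.Iic c)| ≤ ε) := by
  have hs₁ : 0 < s₁ := hs₀.trans hs₀₁
  have hpos : ∀ s₂ ∈ SpectrumMisuse.hypothesisH2 s₀ s₁, 0 < s₂ ∧ s₂ ≠ s₁ := by
    rintro s₂ (⟨h1, h2⟩ | h)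
    · exact ⟨hs₀.trans h1, h2.ne⟩
    · exact ⟨hs₁.trans h, ne_of_gt h⟩
  refine ⟨fun N => ⟨fun y => SpectrumMisuse.contDiffAt_log_likelihood y hs₁,
      SpectrumMisuse.integrable_logLikelihoodSecondDeriv N hs₁,
      SpectrumMisuse.fisherInfo_eq N hs₁⟩,
    fun N s₂ _ => SpectrumMisuse.sqrt_noncentrality N hs₁ s₂,
    fun N hN s₂ hs₂ => ?_, fun C ε hε => ?_, fun ε hε => ?_⟩
  · filter_upwards [SpectrumMisuse.ae_ne_zero_sampleLaw hN (hpos s₂ hs₂).1] with y hy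
    exact SpectrumMisuse.zStat_sq hy hs₁ (hpos s₂ hs₂).2
  · obtain ⟨N₀, hN₀⟩ := SpectrumMisuse.exists_forall_le_abs_measureReal_rootStat_sub_le
      (max C √C) (half_pos hε)
    -- `N ≥ 1` is needed for `y ≠ 0` almost surely.
    refine ⟨max N₀ 1, fun N hN s₂ hs₂ c hc => ?_⟩
    obtain ⟨h0, hne⟩ := hpos s₂ hs₂
    refine SpectrumMisuse.abs_statistics_sub_le ((le_max_right _ _).trans hN) hs₁ h0 hne hε.le
      fun t ht => hN₀ N ((le_max_left _ _).trans hN) _ _ (div_pos h0 hs₁) ?_ t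
        (ht.trans (max_le_max hc (Real.sqrt_le_sqrt hc)))
    rcases hne.lt_or_gt with h | h
    · exact Or.inr ⟨Real.sign_of_neg (sub_neg.mpr h), (div_lt_one hs₁).mpr h⟩
    · exact Or.inl ⟨Real.sign_of_pos (sub_pos.mpr h), (one_lt_div hs₁).mpr h⟩
  · obtain ⟨δ, hδ, N₀, hN₀⟩ := SpectrumMisuse.exists_forall_abs_measureReal_rootStat_sub_le
      (half_pos hε)
    refine ⟨δ, hδ, max N₀ 1, fun N hN s₂ hs₂ hθ c => ?_⟩
    obtain ⟨h0, hne⟩ := hpos s₂ hs₂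
    rw [SpectrumMisuse.noncentrality_eq N hs₁] at hθ
    exact SpectrumMisuse.abs_statistics_sub_le ((le_max_right _ _).trans hN) hs₁ h0 hne hε.le
      fun t _ => hN₀ N ((le_max_left _ _).trans hN) _ _
        (Real.sign_apply_eq_of_ne_zero _ (sub_ne_zero.mpr hne)).symm hθ t
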